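/- **Theorem 8.3.** Let $R$ be an associative ring with $1$ (not necessarily commutative) and let $S=\begin{pmatrix}A&B\\C&D\end{pmatrix}$ be a linear switch over $R$, that is, $S\in M_2(R)$ is invertible and, with the $3\times3$ matrices $S\times\mathrm{id}=\begin{pmatrix}A&B&0\\C&D&0\\0&0&1\end{pmatrix}$ and $\mathrm{id}\times S=\begin{pmatrix}1&0&0\\0&A&B\\0&C&D\end{pmatrix}$, $$(S\times\mathrm{id})(\mathrm{id}\times S)(S\times\mathrm{id})=(\mathrm{id}\times S)(S\times\mathrm{id})(\mathrm{id}\times S).$$ Assume that $B$ and $C$ are invertible. An oriented virtual link diagram $\mathcal D$ is a 4-regular plane graph with oriented strands (closed components without crossings are allowed) whose vertices are positive, negative (classical) or virtual crossings. Its semi-arcs are the maximal portions that meet no classical crossing except at their ends, labels being carried straight through virtual crossings; a component without classical crossings is one semi-arc. Let $\mathcal M(S,\mathcal D)$ be the left $R$-module generated by the semi-arcs with two relations $$c=Aa+Bb,\qquad d=Ca+Db$$ for each classical crossing. Here the crossing is drawn with both strands running from west to east; at a positive crossing (the strand from NW to SE is over) $a,b,c,d$ are the semi-arcs at SW, NW,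 SE, NE, and at a negative crossing (the strand from SW to NE is over) they are the semi-arcs at SE, NE, SW, NW, respectively. 1. If $\mathcal D$ and $\mathcal D'$ are related by any sequence of virtual Reidemeister moves other than the classical first Reidemeister move (that is: classical second and third moves; the virtual first, second and third moves; the mixed move, which takes an arc with two consecutive virtual crossings across a classical crossing; all with all orientations), then $\mathcal M(S,\mathcal D)\cong\mathcal M(S,\mathcal D')$ as $R$-modules. 2. Suppose in addition that $A$ is invertible, or $D$ is invertible, or there is a unit $\lambda\in R$ with $S\binom{1}{\lambda}=\binom{1}{\lambda}$. If $\mathcal D$ and $\mathcal D'$ are related by any sequence of virtual Reidemeister moves, including the classical first move, then $\mathcal M(S,\mathcal D)\cong\mathcal M(S,\mathcal D')$. Hence $\mathcal M(S,\cdot)$ is an invariant of oriented virtual knots and links. -/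

import Mathlib

namespace VirtualKnot

/-- A linear switch: an invertible `2 × 2` matrix `S` over an associative (not necessarily
commutative) ring with `(S × id)(id × S)(S × id) = (id × S)(S × id)(id × S)`. -/
structure IsLinearSwitch {R : Type*} [Ring R] (S : Matrix (Fin 2) (Fin 2) R) : Prop where
  isUnit : IsUnit S
  yangBaxter :
    (!![S 0 0, S 0 1, 0; S 1 0, S 1 1, 0; 0, 0, 1] * !![1, 0, 0; 0, S 0 0, S 0 1; 0, S 1 0, S 1 1] *
      !![S 0 0, S 0 1, 0; S 1 0, S 1 1, 0; 0, 0, 1] : Matrix (Fin 3) (Fin 3) R) =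
    !![1, 0, 0; 0, S 0 0, S 0 1; 0, S 1 0, S 1 1] * !![S 0 0, S 0 1, 0; S 1 0, S 1 1, 0; 0, 0, 1] *
      !![1, 0, 0; 0, S 0 0, S 0 1; 0, S 1 0, S 1 1]

/-- The three kinds of crossings; the positive and negative ones are the classical (real) ones. -/
inductive Kind
  | positive
  | negative
  | virtual
  deriving DecidableEq

/-- The kind of the crossing after over and under have been exchanged. -/
def Kind.flip : Kind → Kind
  | .positive => .negative
  | .negative => .positive
  | .virtual => .virtual

/-- A node of an oriented diagram whose edges are labelled by natural numbers.

`crossing k iL iR oL oR` is a crossing of kind `k`. Turn the picture so that both strands run from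
west to east. Then `iL` is the edge in the north-west and `iR` the edge in the south-west (both
incoming), `oL` is the edge in the north-east and `oR` the edge in the south-east (both outgoing).
One strand is `iL → oR`, the other one is `iR → oL`. At a positive crossing `iL → oR` is the
overcrossing strand, at a negative crossing `iR → oL` is.

`point i o` is a marked point on an arc, with incoming edge `i` and outgoing edge `o`. Marked points
have no meaning of their own: they can be inserted and deleted on every edge. A circle without
crossings is drawn with at least one of them, for example as `point e e`. -/
inductive Node
  | crossing (k : Kind) (iL iR oL oR : ℕ)
  | point (i o : ℕ)
  deriving DecidableEq

namespace Node

/-- The incoming edges of a node. -/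
def ins : Node → Multiset ℕ
  | crossing _ iL iR _ _ => {iL, iR}
  | point i _ => {i}

/-- The outgoing edges of a node. -/
def outs : Node → Multiset ℕ
  | crossing _ _ _ oL oR => {oL, oR}
  | point _ o => {o}

/-- Change of the edge labels. -/
def relabel (f : ℕ → ℕ) : Node → Node
  | crossing k iL iR oL oR => crossing k (f iL) (f iR) (f oL) (f oR)
  | point i o => point (f i) (f o)

/-- `1` for a crossing, `0` for a marked point. -/
def crossingCount : Node → ℕ
  | crossing _ _ _ _ _ => 1
  | point _ _ => 0

/-- The edge `e` runs into this node and continues straight through it as the edge `f`, where the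
node is a virtual crossing or a marked point. -/
def Through : Node → ℕ → ℕ → Prop
  | crossing .virtual iL iR oL oR, e, f => (e = iL ∧ f = oR) ∨ (e = iR ∧ f = oL)
  | crossing .positive _ _ _ _, _, _ => False
  | crossing .negative _ _ _ _, _, _ => False
  | point i o, e, f => e = i ∧ f = o

end Node

/-- The two sides of an oriented edge. -/
inductive Side
  | left
  | right
  deriving DecidableEq

/-- Two edge sides that meet in a corner of the node. The four corners of a crossing are (in the
position described above) the northern, the southern, the western and the eastern one. -/
def Node.Corner : Node → ℕ × Side → ℕ × Side → Prop
  | .crossing _ iL iR oL oR, p, q =>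
      (p = (iL, .left) ∧ q = (oL, .left)) ∨ (p = (iR, .right) ∧ q = (oR, .right)) ∨
      (p = (iL, .right) ∧ q = (iR, .left)) ∨ (p = (oL, .right) ∧ q = (oR, .left))
  | .point i o, p, q => ∃ s, p = (i, s) ∧ q = (o, s)

/-- An oriented graph with crossings and marked points as nodes: every edge leaves exactly one node
and enters exactly one node. -/
structure Code where
  nodes : Multiset Node
  nodup : (nodes.bind Node.ins).Nodup
  ins_eq_outs : nodes.bind Node.ins = nodes.bind Node.outs

namespace Code

/-- The edges. -/
def Edge (D : Code) : Type := {e : ℕ // e ∈ D.nodes.bind Node.ins}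

/-- The connected components of the graph. -/
def Component (D : Code) : Type :=
  Quot fun e f : D.Edge => ∃ v ∈ D.nodes, e.1 ∈ v.ins + v.outs ∧ f.1 ∈ v.ins + v.outs

/-- The faces, as the classes of edge sides under going around corners: the boundary cycles of the
rotation system. -/
def Face (D : Code) : Type :=
  Quot fun p q : D.Edge × Side => ∃ v ∈ D.nodes, v.Corner (p.1.1, p.2) (q.1.1, q.2)

/-- The number of crossings. -/
def crossingNumber (D : Code) : ℕ := (D.nodes.map Node.crossingCount).sum

/-- The graph, with its cyclic order at the nodes, lies on the sphere: every connected component has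
Euler characteristic `2`. With `n` crossings and `p` marked points there are `n + p` nodes and
`2 * n + p` edges, so that this says `(n + p) - (2 * n + p) + F = 2 * c`. -/
def IsPlane (D : Code) : Prop :=
  Nat.card D.Face = D.crossingNumber + 2 * Nat.card D.Component

end Code

/-- An oriented virtual link diagram: a plane graph that is 4-regular (apart from marked points on its
arcs), each of whose crossings is positive, negative or virtual. -/
structure Diagram extends Code where
  isPlane : toCode.IsPlane

namespace Diagram

/-- The semi-arcs: maximal portions of the diagram that run through no classical crossing, that is,
edges up to going straight through virtual crossings and marked points. A component without
classical crossings is a single semi-arc. -/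
def SemiArc (D : Diagram) : Type :=
  Quot fun e f : D.Edge => ∃ v ∈ D.nodes, v.Through e.1 f.1

section KnotModule

variable {R : Type*} [Ring R]

/-- The generator that belongs to the semi-arc of an edge. -/
noncomputable def gen (R : Type*) [Ring R] (D : Diagram) (e : D.Edge) : D.SemiArc →₀ R :=
  Finsupp.single (Quot.mk _ e) 1

/-- The two relations `c = A a + B b`, `d = C a + D b` of every classical crossing.
Positive crossing: `a` south-west, `b` north-west, `c` south-east, `d` north-east.
Negative crossing: `a` south-east, `b` north-east, `c` south-west, `d` north-west. -/
def relations (S : Matrix (Fin 2) (Fin 2) R) (D : Diagram) : Set (D.SemiArc →₀ R) :=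
  {x | ∃ a b c d : D.Edge,
    (Node.crossing .positive b.1 a.1 d.1 c.1 ∈ D.nodes ∨
      Node.crossing .negative d.1 c.1 b.1 a.1 ∈ D.nodes) ∧
    (x = gen R D c - (S 0 0 • gen R D a + S 0 1 • gen R D b) ∨
      x = gen R D d - (S 1 0 • gen R D a + S 1 1 • gen R D b))}

/-- The left `R`-module presented by the semi-arcs and two relations per classical crossing. -/
abbrev KnotModule (S : Matrix (Fin 2) (Fin 2) R) (D : Diagram) : Type _ :=
  (D.SemiArc →₀ R) ⧸ Submodule.span R (D.relations S)

end KnotModule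

/-- The classical first Reidemeister move, in all its oriented versions (the loop on the right or on
the left of the strand; the crossing positive or negative). -/
inductive ClassicalKink : Multiset Node → Multiset Node → Prop
  | right (k : Kind) (hk : k ≠ .virtual) (a l b : ℕ) :
      ClassicalKink {.crossing k a l b l} {.point a b}
  | left (k : Kind) (hk : k ≠ .virtual) (a l b : ℕ) :
      ClassicalKink {.crossing k l a l b} {.point a b}

/-- The triples of crossing kinds in a third move: three virtual crossings (purely virtual move), two
virtual and one classical (mixed move), or three classical ones, not in one of the two patterns
`p`, `n` in which the three strands would lie over one another cyclically. -/
def TripleAllowed (p n : Kind × Kind × Kind) (t : Kind × Kind × Kind) : Prop :=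
  (t.1 = .virtual ∧ t.2.1 = .virtual) ∨ (t.1 = .virtual ∧ t.2.2 = .virtual) ∨
  (t.2.1 = .virtual ∧ t.2.2 = .virtual) ∨
  (t.1 ≠ .virtual ∧ t.2.1 ≠ .virtual ∧ t.2.2 ≠ .virtual ∧ t ≠ p ∧ t ≠ n)

/-- The local pictures of all other moves: the virtual first move, and the classical, virtual and
mixed second and third moves, with all orientations of the strands. -/
inductive LocalMove : Multiset Node → Multiset Node → Prop
  /-- Virtual first move, loop on the right. -/
  | virtualKinkRight (a l b : ℕ) : LocalMove {.crossing .virtual a l b l} {.point a b}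
  /-- Virtual first move, loop on the left. -/
  | virtualKinkLeft (a l b : ℕ) : LocalMove {.crossing .virtual l a l b} {.point a b}
  /-- Second move (classical, or purely virtual), two strands `a → c`, `b → d` in the same direction. -/
  | parallel (k : Kind) (a b c d x y : ℕ) :
      LocalMove {.crossing k a b x y, .crossing k.flip x y c d} {.point a c, .point b d}
  /-- Second move, strands in opposite directions, with the bigon traversed clockwise. -/
  | antiparallelCw (k : Kind) (a b c d x y : ℕ) :
      LocalMove {.crossing k a y d x, .crossing k.flip b x c y} {.point a c, .point b d}
  /-- Second move, strands in opposite directions, with the bigon traversed counterclockwise. -/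
  | antiparallelCcw (k : Kind) (a b c d x y : ℕ) :
      LocalMove {.crossing k y a x d, .crossing k.flip x b y c} {.point a c, .point b d}
  /-- Third move, with the triangle not coherently oriented (three strands `aᵢ → zᵢ` from west to
  east, `k₁₂`, `k₁₃`, `k₂₃` being the kinds of the crossings of the strands). -/
  | braidTriangle (k₁₂ k₁₃ k₂₃ : Kind)
      (hk : TripleAllowed (.positive, .negative, .positive) (.negative, .positive, .negative)
        (k₁₂, k₁₃, k₂₃))
      (a₁ a₂ a₃ z₁ z₂ z₃ m₁ m₂ m₃ n₁ n₂ n₃ : ℕ) :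
      LocalMove
        {.crossing k₁₂ a₁ a₂ m₂ m₁, .crossing k₁₃ m₁ a₃ m₃ z₁, .crossing k₂₃ m₂ m₃ z₃ z₂}
        {.crossing k₂₃ a₂ a₃ n₃ n₂, .crossing k₁₃ a₁ n₃ z₃ n₁, .crossing k₁₂ n₁ n₂ z₂ z₁}
  /-- Third move, with the triangle coherently oriented: the preceding picture with the second strand
  reversed. -/
  | cyclicTriangle (k₁₂ k₁₃ k₂₃ : Kind)
      (hk : TripleAllowed (.positive, .positive, .positive) (.negative, .negative, .negative)
        (k₁₂, k₁₃, k₂₃))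
      (a₁ a₂ a₃ z₁ z₂ z₃ m₁ m₂ m₃ n₁ n₂ n₃ : ℕ) :
      LocalMove
        {.crossing k₁₂ m₂ a₁ m₁ z₂, .crossing k₁₃ m₁ a₃ m₃ z₁, .crossing k₂₃ m₃ a₂ m₂ z₃}
        {.crossing k₂₃ a₃ n₂ z₂ n₃, .crossing k₁₃ a₁ n₃ z₃ n₁, .crossing k₁₂ a₂ n₁ z₁ n₂}

/-- One step between diagrams that does not use the classical first move. In a local move the nodes
`P` are replaced by `Q` and the rest of the diagram stays as it is; since both `D` and `D'` are
diagrams, the inner edges of `P` and `Q` do not occur in the rest. -/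
inductive RegularMove (D D' : Diagram) : Prop
  /-- A change of the names of the edges. -/
  | relabel (f : ℕ → ℕ) (hf : Function.Injective f) (h : D'.nodes = D.nodes.map (Node.relabel f))
  /-- Insertion of a marked point: the edge `e` of `D` is cut into `e` and `f`. -/
  | subdivide (K : Multiset Node) (e f : ℕ) (hef : e ≠ f)
      (h : D.nodes = K.map (Node.relabel fun x => if x = f then e else x))
      (h' : D'.nodes = .point e f ::ₘ K)
  /-- A virtual first move, or a second or third move. -/
  | move (P Q K : Multiset Node) (hPQ : LocalMove P Q) (h : D.nodes = P + K) (h' : D'.nodes = Q + K)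

/-- One step between diagrams: one of the above, or a classical first Reidemeister move. -/
inductive Move (D D' : Diagram) : Prop
  | regular (h : RegularMove D D')
  | kink (P Q K : Multiset Node) (hPQ : ClassicalKink P Q) (h : D.nodes = P + K)
      (h' : D'.nodes = Q + K)

/-- Two diagrams represent the same oriented virtual link. -/
def Equivalent : Diagram → Diagram → Prop := Relation.EqvGen Move

/-- Two diagrams are related by moves other than the classical first Reidemeister move. -/
def RegularlyEquivalent : Diagram → Diagram → Prop := Relation.EqvGen RegularMove

end Diagram

end VirtualKnot

/-! The knot module is studied through its homomorphisms. For a left `R`-module `N`, a linear map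
from `KnotModule S D` to `N` is the same as a colouring of `D`: a labelling of the edges by elements of
`N` that is carried straight through virtual crossings and marked points and is transformed at a
classical crossing by the permutation `(a, b) ↦ (A a + B b, C a + D b)` of `N × N` or by its inverse
(`exists_linearMap_univLabel`, `linearMap_ext_univLabel`). So it suffices that the two diagrams of a move
have naturally corresponding colourings (`nonempty_linearEquiv_of_coloringMatch`), and this depends
only on the picture that is replaced: for given labels at its boundary both sides must be
colourable or not together, and in at most one way (`LocalMatch`).

For this the linear structure is no longer needed. A switch with `B` and `C` invertible acts on
`N × N` as a birack (`IsBirack`), that is, a solution of the set-theoretic Yang–Baxter equation whose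
sideways maps are bijective. The second moves follow from bijectivity and sideways bijectivity. The
third moves with a triangle that is not coherently oriented are the Yang–Baxter equation
and its conjugates by inverses (`IsBirack.braid`). The third moves with a coherently oriented
triangle reduce by the threefold symmetry of the picture, and by passing to the inverse birack, to one
arrangement of signs, where the Yang–Baxter equation is evaluated at a triple of inner labels
(`IsBirack.cyclicCompatible`). With at least two virtual crossings all third moves are formal.

The classical first move needs that a curl carries the same label at both ends and that this label
determines that of the loop (`HasLoopLabels`). This holds as soon as the switch fixes a vector
`(1, l)` with `l` a unit, and the Yang–Baxter equation provides one if `A` or `D` is invertible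
(`IsLinearSwitch.exists_fixed`). -/

open Function

universe u

namespace VirtualKnot

/-! ### Biracks -/

section Birack

variable {X : Type*}

/-- Both sideways maps of `σ` are bijective: in `σ (a, b) = (c, d)`, the pair `(a, c)` determines
`(b, d)` and the pair `(b, d)` determines `(a, c)`. -/
structure IsNondegenerate (σ : Equiv.Perm (X × X)) : Prop where
  fst : ∀ a, Bijective fun b => (σ (a, b)).1
  snd : ∀ b, Bijective fun a => (σ (a, b)).2

theorem IsNondegenerate.inv {σ : Equiv.Perm (X × X)} (h : IsNondegenerate σ) :
    IsNondegenerate σ⁻¹ where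
  fst c := by
    refine ⟨fun d d' hd => ?_, fun a => ?_⟩
    · obtain ⟨⟨a, b⟩, hab⟩ := σ.surjective (c, d)
      obtain ⟨⟨a', b'⟩, hab'⟩ := σ.surjective (c, d')
      simp only [← hab, ← hab', Equiv.Perm.inv_def, Equiv.symm_apply_apply] at hd
      subst hd
      have hb : b = b' := (h.fst a).1 (by simp [hab, hab'])
      subst hb
      simpa using hab.symm.trans hab'
    · obtain ⟨b, hb⟩ := (h.fst a).2 c
      refine ⟨(σ (a, b)).2, ?_⟩
      have : (c, (σ (a, b)).2) = σ (a, b) := Prod.ext hb.symm rfl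
      simp [this]
  snd d := by
    refine ⟨fun c c' hd => ?_, fun b => ?_⟩
    · obtain ⟨⟨a, b⟩, hab⟩ := σ.surjective (c, d)
      obtain ⟨⟨a', b'⟩, hab'⟩ := σ.surjective (c', d)
      simp only [← hab, ← hab', Equiv.Perm.inv_def, Equiv.symm_apply_apply] at hd
      subst hd
      have ha : a = a' := (h.snd b).1 (by simp [hab, hab'])
      subst ha
      simpa using hab.symm.trans hab'
    · obtain ⟨a, ha⟩ := (h.snd b).2 d
      refine ⟨(σ (a, b)).1, ?_⟩
      have : ((σ (a, b)).1, d) = σ (a, b) := Prod.ext rfl ha.symm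
      simp [this]

theorem isNondegenerate_prodComm : IsNondegenerate (Equiv.prodComm X X) where
  fst _ := bijective_id
  snd _ := bijective_id

/-- `σ × id` on `X × X × X`. -/
def onLeft (σ : Equiv.Perm (X × X)) : Equiv.Perm (X × X × X) where
  toFun p := ((σ (p.1, p.2.1)).1, (σ (p.1, p.2.1)).2, p.2.2)
  invFun p := ((σ⁻¹ (p.1, p.2.1)).1, (σ⁻¹ (p.1, p.2.1)).2, p.2.2)
  left_inv p := by simp
  right_inv p := by simp

/-- `id × σ` on `X × X × X`. -/
def onRight (σ : Equiv.Perm (X × X)) : Equiv.Perm (X × X × X) where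
  toFun p := (p.1, σ p.2)
  invFun p := (p.1, σ⁻¹ p.2)
  left_inv p := by simp
  right_inv p := by simp

theorem onLeft_inv (σ : Equiv.Perm (X × X)) : onLeft σ⁻¹ = (onLeft σ)⁻¹ := rfl

theorem onRight_inv (σ : Equiv.Perm (X × X)) : onRight σ⁻¹ = (onRight σ)⁻¹ := rfl

/-- A birack on the set `X`: a nondegenerate solution of the set-theoretic Yang–Baxter equation. -/
structure IsBirack (σ : Equiv.Perm (X × X)) : Prop extends IsNondegenerate σ where
  yangBaxter : onLeft σ * onRight σ * onLeft σ = onRight σ * onLeft σ * onRight σ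

theorem IsBirack.inv {σ : Equiv.Perm (X × X)} (h : IsBirack σ) : IsBirack σ⁻¹ where
  toIsNondegenerate := h.toIsNondegenerate.inv
  yangBaxter := by
    rw [onLeft_inv, onRight_inv]
    simpa [mul_assoc] using congrArg (·⁻¹) h.yangBaxter

/-- The map `(south-west, north-west) ↦ (south-east, north-east)` of a crossing of the given
kind, where positive crossings act by `σ`. -/
def kindPerm (σ : Equiv.Perm (X × X)) : Kind → Equiv.Perm (X × X)
  | .positive => σ
  | .negative => σ⁻¹
  | .virtual => Equiv.prodComm X X

theorem kindPerm_flip (σ : Equiv.Perm (X × X)) (k : Kind) :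
    kindPerm σ k.flip = (kindPerm σ k)⁻¹ := by
  cases k <;> rfl

theorem IsNondegenerate.kindPerm {σ : Equiv.Perm (X × X)} (h : IsNondegenerate σ) (k : Kind) :
    IsNondegenerate (kindPerm σ k) := by
  cases k
  exacts [h, h.inv, isNondegenerate_prodComm]

/-- The Yang–Baxter equation for three permutations, in the arrangement of the third Reidemeister
move `LocalMove.braidTriangle`. -/
theorem IsBirack.braid {σ : Equiv.Perm (X × X)} (h : IsBirack σ) {k₁₂ k₁₃ k₂₃ : Kind}
    (hk : Diagram.TripleAllowed (.positive, .negative, .positive) (.negative, .positive, .negative)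
      (k₁₂, k₁₃, k₂₃)) :
    onRight (kindPerm σ k₂₃) * onLeft (kindPerm σ k₁₃) * onRight (kindPerm σ k₁₂) =
      onLeft (kindPerm σ k₁₂) * onRight (kindPerm σ k₁₃) * onLeft (kindPerm σ k₂₃) := by
  rcases hk with ⟨h1, h2⟩ | ⟨h1, h2⟩ | ⟨h1, h2⟩ | ⟨h1, h2, h3, hp, hn⟩
  iterate 3
    simp only at h1 h2
    subst h1 h2
    ext ⟨x, y, z⟩ <;> rfl
  have e := h.yangBaxter
  have e' := h.inv.yangBaxter
  rw [onLeft_inv, onRight_inv] at e'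
  generalize hl : onLeft σ = l at *
  generalize hr : onRight σ = r at *
  have p : r⁻¹ * l * r = l * r * l⁻¹ := by
    rw [eq_mul_inv_iff_mul_eq, mul_assoc, mul_assoc, inv_mul_eq_iff_eq_mul, ← mul_assoc,
      ← mul_assoc, e]
  have q : r * l * r⁻¹ = l⁻¹ * r * l := by
    rw [mul_inv_eq_iff_eq_mul, mul_assoc, mul_assoc, eq_inv_mul_iff_mul_eq, ← mul_assoc,
      ← mul_assoc, e]
  cases k₁₂ <;> cases k₁₃ <;> cases k₂₃ <;>
    simp only [ne_eq, not_true_eq_false, reduceCtorEq, not_false_eq_true] at h1 h2 h3 hp hn <;>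
    simp only [kindPerm, onLeft_inv, onRight_inv, hl, hr]
  exacts [e.symm, p, by simpa [mul_assoc] using congrArg (·⁻¹) p, q,
    by simpa [mul_assoc] using congrArg (·⁻¹) q, e'.symm]

/-- The two sides of the third Reidemeister move `LocalMove.cyclicTriangle` allow the same labels
at the boundary, where the three crossings act by `T₁₂`, `T₁₃` and `T₂₃`. -/
def CyclicCompatible (T₁₂ T₁₃ T₂₃ : Equiv.Perm (X × X)) : Prop :=
  ∀ a₁ a₂ a₃ z₁ z₂ z₃ : X,
    (∃ m₁ m₂ m₃, T₁₂ (a₁, m₂) = (z₂, m₁) ∧ T₁₃ (a₃, m₁) = (z₁, m₃) ∧ T₂₃ (a₂, m₃) = (z₃, m₂)) ↔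
    ∃ n₁ n₂ n₃, T₂₃ (n₂, a₃) = (n₃, z₂) ∧ T₁₃ (n₃, a₁) = (n₁, z₃) ∧ T₁₂ (n₁, a₂) = (n₂, z₁)

/-- The coherently oriented triangle has a threefold symmetry. -/
theorem CyclicCompatible.rotate {T₁₂ T₁₃ T₂₃ : Equiv.Perm (X × X)}
    (h : CyclicCompatible T₁₂ T₁₃ T₂₃) : CyclicCompatible T₁₃ T₂₃ T₁₂ := by
  intro a₁ a₂ a₃ z₁ z₂ z₃
  refine Iff.trans ?_ ((h a₂ a₃ a₁ z₂ z₃ z₁).trans ?_)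
  · exact ⟨fun ⟨m₁, m₂, m₃, e₁, e₂, e₃⟩ => ⟨m₂, m₃, m₁, e₃, e₁, e₂⟩,
      fun ⟨m₂, m₃, m₁, e₃, e₁, e₂⟩ => ⟨m₁, m₂, m₃, e₁, e₂, e₃⟩⟩
  · exact ⟨fun ⟨n₂, n₃, n₁, e₁, e₂, e₃⟩ => ⟨n₁, n₂, n₃, e₃, e₁, e₂⟩,
      fun ⟨n₁, n₂, n₃, e₃, e₁, e₂⟩ => ⟨n₂, n₃, n₁, e₁, e₂, e₃⟩⟩

theorem cyclicCompatible_prodComm (T : Equiv.Perm (X × X)) :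
    CyclicCompatible (Equiv.prodComm X X) (Equiv.prodComm X X) T := by
  intro a₁ a₂ a₃ z₁ z₂ z₃
  simp only [Equiv.prodComm_apply, Prod.swap_prod_mk, Prod.mk.injEq]
  constructor
  · rintro ⟨m₁, m₂, m₃, ⟨rfl, rfl⟩, ⟨rfl, rfl⟩, e⟩
    exact ⟨_, _, _, e, ⟨rfl, rfl⟩, rfl, rfl⟩
  · rintro ⟨n₁, n₂, n₃, e, ⟨rfl, rfl⟩, rfl, rfl⟩
    exact ⟨_, _, _, ⟨rfl, rfl⟩, ⟨rfl, rfl⟩, e⟩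

/-- Both sides of the move are read off from the Yang–Baxter equation at `(n₁, a₂, m₃)`, whose
two halves run through the labels of both triangles. -/
theorem IsBirack.cyclicCompatible {σ : Equiv.Perm (X × X)} (h : IsBirack σ) :
    CyclicCompatible σ σ⁻¹ σ := by
  intro a₁ a₂ a₃ z₁ z₂ z₃
  simp only [Equiv.Perm.inv_eq_iff_eq]
  have yb (x y z : X) := congrArg (· (x, y, z)) h.yangBaxter
  simp only [Equiv.Perm.mul_apply, onLeft, onRight, Equiv.coe_fn_mk, Prod.mk.injEq] at yb
  constructor
  · rintro ⟨m₁, m₂, m₃, e₁, e₂, e₃⟩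
    -- The label `n₁` is forced by the third equation of the other side.
    obtain ⟨n₁, hn₁⟩ := (h.snd a₂).2 z₁
    obtain ⟨n₂, hn₂⟩ : ∃ n₂, σ (n₁, a₂) = (n₂, z₁) := ⟨_, Prod.ext rfl hn₁⟩
    have y := yb n₁ a₂ m₃
    simp only [hn₂, e₃, ← e₂] at y
    obtain ⟨y₁, y₂⟩ := y
    have ha : (σ (n₁, z₃)).2 = a₁ := (h.snd m₂).1 (by simp [← y₂, e₁])
    refine ⟨n₁, n₂, (σ (n₂, a₃)).1, ?_, ?_, hn₂⟩
    · rw [ha, e₁] at y₂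
      exact Prod.ext rfl (congrArg Prod.fst y₂)
    · exact (Prod.ext y₁.symm ha : σ (n₁, z₃) = (_, a₁)).symm
  · rintro ⟨n₁, n₂, n₃, e₁, e₂, e₃⟩
    -- The label `m₃` is forced by the second equation of the other side.
    obtain ⟨m₃, hm₃⟩ := (h.fst z₁).2 a₃
    obtain ⟨m₁, hm₁⟩ : ∃ m₁, σ (z₁, m₃) = (a₃, m₁) := ⟨_, Prod.ext hm₃ rfl⟩
    have y := yb n₁ a₂ m₃
    simp only [e₃, hm₁, e₁] at y
    obtain ⟨y₁, y₂⟩ := y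
    have hz : (σ (a₂, m₃)).1 = z₃ := (h.fst n₁).1 (by simp [← y₁, ← e₂])
    refine ⟨m₁, (σ (a₂, m₃)).2, m₃, ?_, hm₁.symm, Prod.ext hz rfl⟩
    rw [hz, ← e₂] at y₂
    exact y₂.symm

theorem IsBirack.cyclic {σ : Equiv.Perm (X × X)} (h : IsBirack σ) {k₁₂ k₁₃ k₂₃ : Kind}
    (hk : Diagram.TripleAllowed (.positive, .positive, .positive) (.negative, .negative, .negative)
      (k₁₂, k₁₃, k₂₃)) :
    CyclicCompatible (kindPerm σ k₁₂) (kindPerm σ k₁₃) (kindPerm σ k₂₃) := by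
  rcases hk with ⟨h1, h2⟩ | ⟨h1, h2⟩ | ⟨h1, h2⟩ | ⟨h1, h2, h3, hp, hn⟩
  · simp only at h1 h2
    subst h1 h2
    exact cyclicCompatible_prodComm _
  · simp only at h1 h2
    subst h1 h2
    exact (cyclicCompatible_prodComm _).rotate
  · simp only at h1 h2
    subst h1 h2
    exact (cyclicCompatible_prodComm _).rotate.rotate
  have e := h.cyclicCompatible
  have e' := h.inv.cyclicCompatible
  rw [inv_inv] at e'
  cases k₁₂ <;> cases k₁₃ <;> cases k₂₃ <;>
    simp only [ne_eq, not_true_eq_false, reduceCtorEq, not_false_eq_true] at h1 h2 h3 hp hn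
  exacts [e.rotate.rotate, e, e'.rotate, e.rotate, e', e'.rotate.rotate]

end Birack

/-! ### Labels at a curl -/

section Curl

variable {X : Type*}

/-- A strand with a curl, on either side of it, carries the same label `a` before and after the
curl, and the label of the loop is the function `r` (or `s`) of `a`. Together with `IsBirack` this is
the notion of a biquandle. -/
structure HasLoopLabels (σ : Equiv.Perm (X × X)) : Prop where
  right : ∃ r : X → X, ∀ a b l, σ (l, a) = (l, b) ↔ a = b ∧ l = r a
  left : ∃ s : X → X, ∀ a b l, σ (a, l) = (b, l) ↔ a = b ∧ l = s a

theorem HasLoopLabels.inv {σ : Equiv.Perm (X × X)} (h : HasLoopLabels σ) :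
    HasLoopLabels σ⁻¹ where
  right := by
    obtain ⟨r, hr⟩ := h.right
    refine ⟨r, fun a b l => ?_⟩
    rw [Equiv.Perm.inv_eq_iff_eq, eq_comm, hr]
    constructor <;> (rintro ⟨rfl, rfl⟩; exact ⟨rfl, rfl⟩)
  left := by
    obtain ⟨s, hs⟩ := h.left
    refine ⟨s, fun a b l => ?_⟩
    rw [Equiv.Perm.inv_eq_iff_eq, eq_comm, hs]
    constructor <;> (rintro ⟨rfl, rfl⟩; exact ⟨rfl, rfl⟩)

theorem hasLoopLabels_prodComm : HasLoopLabels (Equiv.prodComm X X) where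
  right := ⟨id, fun a b l => by
    simp only [Equiv.prodComm_apply, Prod.swap_prod_mk, Prod.mk.injEq, id_eq]
    constructor <;> (rintro ⟨rfl, rfl⟩; exact ⟨rfl, rfl⟩)⟩
  left := ⟨id, fun a b l => by
    simp only [Equiv.prodComm_apply, Prod.swap_prod_mk, Prod.mk.injEq, id_eq]
    constructor <;> (rintro ⟨rfl, rfl⟩; exact ⟨rfl, rfl⟩)⟩

theorem HasLoopLabels.kindPerm {σ : Equiv.Perm (X × X)} (h : HasLoopLabels σ) (k : Kind) :
    HasLoopLabels (kindPerm σ k) := by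
  cases k
  exacts [h, h.inv, hasLoopLabels_prodComm]

end Curl

/-! ### The action of a linear switch on pairs of module elements -/

section LinearSwitch

variable {R : Type*} [Ring R] {S : Matrix (Fin 2) (Fin 2) R}
variable {N : Type*} [AddCommGroup N] [Module R N]

open scoped Matrix.Module in
/-- The permutation `(a, b) ↦ (A a + B b, C a + D b)` of `N × N` given by an invertible matrix
over `R`, for a left `R`-module `N`. -/
noncomputable def matrixPerm (hS : IsUnit S) (N : Type*) [AddCommGroup N] [Module R N] :
    Equiv.Perm (N × N) :=
  (finTwoArrowEquiv N).permCongr (MulAction.toPerm hS.unit)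

theorem matrixPerm_apply (hS : IsUnit S) (p : N × N) :
    matrixPerm hS N p = (S 0 0 • p.1 + S 0 1 • p.2, S 1 0 • p.1 + S 1 1 • p.2) := by
  simp [matrixPerm, Equiv.permCongr_apply, Units.smul_def, finTwoArrowEquiv]

theorem bijective_smul_of_isUnit {r : R} (hr : IsUnit r) : Bijective fun x : N => r • x := by
  obtain ⟨u, rfl⟩ := hr
  exact MulAction.bijective u

theorem isNondegenerate_matrixPerm (hS : IsUnit S) (hB : IsUnit (S 0 1)) (hC : IsUnit (S 1 0)) :
    IsNondegenerate (matrixPerm hS N) where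
  fst a := by
    simp only [matrixPerm_apply]
    exact (Equiv.addLeft (S 0 0 • a)).bijective.comp (bijective_smul_of_isUnit hB)
  snd b := by
    simp only [matrixPerm_apply]
    exact (Equiv.addRight (S 1 1 • b)).bijective.comp (bijective_smul_of_isUnit hC)

open scoped Matrix.Module in
theorem isBirack_matrixPerm (hS : IsLinearSwitch S) (hB : IsUnit (S 0 1)) (hC : IsUnit (S 1 0)) :
    IsBirack (matrixPerm hS.isUnit N) where
  toIsNondegenerate := isNondegenerate_matrixPerm hS.isUnit hB hC
  yangBaxter := by
    have hl (p : N × N × N) :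
        (!![S 0 0, S 0 1, 0; S 1 0, S 1 1, 0; 0, 0, 1] : Matrix (Fin 3) (Fin 3) R) •
          ![p.1, p.2.1, p.2.2] =
        ![(onLeft (matrixPerm hS.isUnit N) p).1, (onLeft (matrixPerm hS.isUnit N) p).2.1,
          (onLeft (matrixPerm hS.isUnit N) p).2.2] := by
      ext i
      fin_cases i <;> simp [onLeft, matrixPerm_apply, Fin.sum_univ_three]
    have hr (p : N × N × N) :
        (!![1, 0, 0; 0, S 0 0, S 0 1; 0, S 1 0, S 1 1] : Matrix (Fin 3) (Fin 3) R) •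
          ![p.1, p.2.1, p.2.2] =
        ![(onRight (matrixPerm hS.isUnit N) p).1, (onRight (matrixPerm hS.isUnit N) p).2.1,
          (onRight (matrixPerm hS.isUnit N) p).2.2] := by
      ext i
      fin_cases i <;> simp [onRight, matrixPerm_apply, Fin.sum_univ_three]
    ext1 p
    have h := congrArg (fun M => M • ![p.1, p.2.1, p.2.2]) hS.yangBaxter
    simp only [mul_smul, hl, hr] at h
    have h0 := congrFun h 0
    have h1 := congrFun h 1
    have h2 := congrFun h 2
    exact Prod.ext h0 (Prod.ext h1 h2)

/-- If a diagonal entry of a linear switch is invertible, then the switch fixes a vector `(1, l)` with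
`l` invertible. With `B` and `C` units, the formulas for `l` come from the entries
`A = A² + BAC`, `BA = AB + BAD` and `D = CDB + D²`, `CD = CDA + DC` of the Yang–Baxter equation. -/
theorem IsLinearSwitch.exists_fixed (hS : IsLinearSwitch S) (hB : IsUnit (S 0 1))
    (hC : IsUnit (S 1 0)) (h : IsUnit (S 0 0) ∨ IsUnit (S 1 1) ∨
      ∃ l : Rˣ, S.mulVec ![1, (l : R)] = ![1, (l : R)]) :
    ∃ l : Rˣ, S 0 0 + S 0 1 * l = 1 ∧ S 1 0 + S 1 1 * l = l := by
  have e (i j : Fin 3) := congrFun (congrFun hS.yangBaxter i) j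
  obtain ⟨B, hB⟩ := hB
  obtain ⟨C, hC⟩ := hC
  rcases h with ⟨A, hA⟩ | ⟨D, hD⟩ | ⟨l, hl⟩
  · have e₁ := e 0 0
    have e₂ := e 0 1
    simp only [Matrix.mul_apply, Fin.sum_univ_three, ← hA, ← hB, ← hC] at e₁ e₂ ⊢
    simp at e₁ e₂
    -- `l` has to be `B⁻¹(1 - A)`, and `1 - A = A⁻¹BAC`.
    refine ⟨B⁻¹ * A⁻¹ * B * A * C, A.isUnit.mul_left_cancel ?_, (B * A).isUnit.mul_left_cancel ?_⟩
    · simpa [mul_add, mul_assoc] using e₁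
    · rw [mul_add, ← mul_assoc _ (S 1 1), Units.val_mul, eq_sub_of_add_eq' e₂]
      simp [sub_mul, mul_assoc]
  · have e₁ := e 2 2
    have e₂ := e 2 1
    simp only [Matrix.mul_apply, Fin.sum_univ_three, ← hD, ← hB, ← hC] at e₁ e₂ ⊢
    simp at e₁ e₂
    -- `l` has to be `(1 - D)⁻¹C`, and `1 - D = D⁻¹CDB`.
    refine ⟨B⁻¹ * D⁻¹ * C⁻¹ * D * C, (C * D).isUnit.mul_left_cancel ?_,
      D.isUnit.mul_left_cancel ?_⟩
    · simpa [mul_add, mul_assoc] using e₂.symm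
    · have := congrArg (· * ((B⁻¹ * D⁻¹ * C⁻¹ * D * C : Rˣ) : R)) e₁
      simpa [add_mul, mul_add, mul_assoc] using this.symm
  · have h0 := congrFun hl 0
    have h1 := congrFun hl 1
    simp [Matrix.mulVec, dotProduct, Fin.sum_univ_two] at h0 h1
    exact ⟨l, h0, h1⟩

/-- When the switch fixes `(1, l)`, the label of the loop of a curl is `l⁻¹ a` or `l a`. -/
theorem hasLoopLabels_matrixPerm (hS : IsUnit S) (hB : IsUnit (S 0 1)) (hC : IsUnit (S 1 0))
    {l : Rˣ} (h₁ : S 0 0 + S 0 1 * l = 1) (h₂ : S 1 0 + S 1 1 * l = l) :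
    HasLoopLabels (matrixPerm hS N) where
  right := by
    refine ⟨fun a => l⁻¹ • a, fun a b x => ?_⟩
    obtain ⟨y, rfl⟩ := MulAction.surjective l a
    have hx : S 0 0 • x + S 0 1 • l • y = x ↔ x = y := by
      rw [eq_sub_of_add_eq h₁, sub_smul, one_smul, Units.smul_def, ← mul_smul, sub_add,
        sub_eq_self, ← smul_sub, ((bijective_smul_of_isUnit (hB.mul l.isUnit)).1.eq_iff'
          (smul_zero _)), sub_eq_zero]
    simp only [matrixPerm_apply, Prod.mk.injEq, hx, inv_smul_smul, and_comm (b := x = y)]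
    refine and_congr_right fun h => ?_
    rw [h, Units.smul_def, ← mul_smul, ← add_smul, h₂]
  left := by
    refine ⟨fun a => l • a, fun a b x => ?_⟩
    have hD : (1 - S 1 1) * l = S 1 0 := by rw [sub_mul, one_mul, sub_eq_iff_eq_add, h₂]
    have hD' : IsUnit (1 - S 1 1) := by rwa [← Units.isUnit_mul_units _ l, hD]
    have hx : S 1 0 • a + S 1 1 • x = x ↔ x = l • a := by
      rw [← hD, mul_smul, ← Units.smul_def, ← eq_sub_iff_add_eq,
        show x - S 1 1 • x = (1 - S 1 1) • x by rw [sub_smul, one_smul],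
        (bijective_smul_of_isUnit hD').1.eq_iff, eq_comm]
    simp only [matrixPerm_apply, Prod.mk.injEq, hx]
    refine and_congr_left fun h => ?_
    rw [h, Units.smul_def, ← mul_smul, ← add_smul, h₁, one_smul]

end LinearSwitch

/-! ### Colourings, and the knot module as their universal target -/

section Coloring

variable {X : Type*}

/-- The labels `f` of the edges are compatible at a node, where a crossing of kind `k` acts by
`kindPerm σ k`, from the southern and northern incoming edge to the southern and northern outgoing
one, and labels are carried straight through marked points. -/
def Node.IsColored (σ : Equiv.Perm (X × X)) (f : ℕ → X) : Node → Prop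
  | crossing k iL iR oL oR => kindPerm σ k (f iR, f iL) = (f oR, f oL)
  | point i o => f i = f o

/-- A colouring of a set of nodes by `X`. Only the labels of edges at these nodes matter. -/
def IsColoring (σ : Equiv.Perm (X × X)) (V : Multiset Node) (f : ℕ → X) : Prop :=
  ∀ v ∈ V, v.IsColored σ f

theorem isColoring_add {σ : Equiv.Perm (X × X)} {V W : Multiset Node} {f : ℕ → X} :
    IsColoring σ (V + W) f ↔ IsColoring σ V f ∧ IsColoring σ W f := by
  simp only [IsColoring, Multiset.mem_add, or_imp, forall_and]

theorem Node.IsColored.congr {σ : Equiv.Perm (X × X)} {v : Node} {f g : ℕ → X}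
    (h : v.IsColored σ f) (hi : ∀ e ∈ v.ins, f e = g e) (ho : ∀ e ∈ v.outs, f e = g e) :
    v.IsColored σ g := by
  cases v <;> simp_all [Node.IsColored, Node.ins, Node.outs]

theorem IsColoring.congr {σ : Equiv.Perm (X × X)} {V : Multiset Node} {f g : ℕ → X}
    (h : IsColoring σ V f) (hi : ∀ e ∈ V.bind Node.ins, f e = g e)
    (ho : ∀ e ∈ V.bind Node.outs, f e = g e) : IsColoring σ V g := fun v hv =>
  (h v hv).congr (fun e he => hi e (Multiset.mem_bind.mpr ⟨v, hv, he⟩))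
    fun e he => ho e (Multiset.mem_bind.mpr ⟨v, hv, he⟩)

theorem isColoring_map_relabel {σ : Equiv.Perm (X × X)} {V : Multiset Node} {f : ℕ → X}
    (r : ℕ → ℕ) : IsColoring σ (V.map (Node.relabel r)) f ↔ IsColoring σ V (f ∘ r) := by
  simp only [IsColoring, Multiset.mem_map, forall_exists_index, and_imp, forall_apply_eq_imp_iff₂]
  refine forall₂_congr fun v _ => ?_
  cases v <;> rfl

theorem IsColoring.eq_of_through {σ : Equiv.Perm (X × X)} {V : Multiset Node} {f : ℕ → X}
    (hf : IsColoring σ V f) {v : Node} (hv : v ∈ V) {e e' : ℕ}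
    (h : v.Through e e') : f e = f e' := by
  have := hf v hv
  rcases v with ⟨_ | _ | _, iL, iR, oL, oR⟩ | ⟨i, o⟩
  · exact h.elim
  · exact h.elim
  · have := Prod.ext_iff.mp this
    rcases h with ⟨rfl, rfl⟩ | ⟨rfl, rfl⟩
    exacts [this.1, this.2]
  · obtain ⟨rfl, rfl⟩ := h
    exact this

theorem IsColoring.map_linearMap {R : Type*} [Ring R] {S : Matrix (Fin 2) (Fin 2) R} {hS : IsUnit S}
    {N N' : Type*} [AddCommGroup N] [Module R N] [AddCommGroup N'] [Module R N']
    {V : Multiset Node} {f : ℕ → N} (hf : IsColoring (matrixPerm hS N) V f) (φ : N →ₗ[R] N') :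
    IsColoring (matrixPerm hS N') V (φ ∘ f) := by
  have key (p q : N × N) (h : matrixPerm hS N p = q) :
      matrixPerm hS N' (φ p.1, φ p.2) = (φ q.1, φ q.2) := by
    simp [← h, matrixPerm_apply]
  intro v hv
  have := hf v hv
  rcases v with ⟨_ | _ | _, iL, iR, oL, oR⟩ | ⟨i, o⟩
  · exact key _ _ this
  · exact Equiv.Perm.inv_eq_iff_eq.mpr
      (key _ _ (Equiv.Perm.inv_eq_iff_eq.mp this).symm).symm
  · have := Prod.ext_iff.mp this
    exact Prod.ext (congrArg φ this.1) (congrArg φ this.2)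
  · exact congrArg φ this

end Coloring

namespace Diagram

variable {R : Type*} [Ring R] {S : Matrix (Fin 2) (Fin 2) R}
variable {N : Type*} [AddCommGroup N] [Module R N]

/-- The edge labels of a diagram, as a multiset. -/
abbrev edges (D : Diagram) : Multiset ℕ := D.nodes.bind Node.ins

theorem mem_edges_of_mem_ins {D : Diagram} {v : Node} (hv : v ∈ D.nodes) {e : ℕ} (he : e ∈ v.ins) :
    e ∈ D.edges := Multiset.mem_bind.mpr ⟨v, hv, he⟩

theorem mem_edges_of_mem_outs {D : Diagram} {v : Node} (hv : v ∈ D.nodes) {e : ℕ}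
    (he : e ∈ v.outs) : e ∈ D.edges := by
  rw [edges, D.ins_eq_outs]
  exact Multiset.mem_bind.mpr ⟨v, hv, he⟩

open Classical in
/-- The label of an edge by the class of its semi-arc in the knot module; numbers that are not edges
are labelled `0`. -/
noncomputable def univLabel (S : Matrix (Fin 2) (Fin 2) R) (D : Diagram) (e : ℕ) :
    D.KnotModule S :=
  if h : e ∈ D.edges then Submodule.Quotient.mk (gen R D ⟨e, h⟩) else 0

theorem univLabel_of_mem {D : Diagram} {e : ℕ} (h : e ∈ D.edges) :
    univLabel S D e = Submodule.Quotient.mk (gen R D ⟨e, h⟩) := dif_pos h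

theorem univLabel_eq_of_through {D : Diagram} {v : Node} (hv : v ∈ D.nodes) {e f : ℕ}
    (he : e ∈ D.edges) (hf : f ∈ D.edges) (h : v.Through e f) :
    univLabel S D e = univLabel S D f := by
  have : (Quot.mk _ ⟨e, he⟩ : D.SemiArc) = Quot.mk _ ⟨f, hf⟩ := Quot.sound ⟨v, hv, h⟩
  rw [univLabel_of_mem he, univLabel_of_mem hf]
  exact congrArg (fun s => Submodule.Quotient.mk (Finsupp.single s (1 : R))) this

theorem matrixPerm_univLabel {D : Diagram} (hS : IsUnit S) {a b c d : ℕ} (ha : a ∈ D.edges)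
    (hb : b ∈ D.edges) (hc : c ∈ D.edges) (hd : d ∈ D.edges)
    (h : Node.crossing .positive b a d c ∈ D.nodes ∨ Node.crossing .negative d c b a ∈ D.nodes) :
    matrixPerm hS _ (univLabel S D a, univLabel S D b) =
      (univLabel S D c, univLabel S D d) := by
  rw [matrixPerm_apply, univLabel_of_mem ha, univLabel_of_mem hb, univLabel_of_mem hc,
    univLabel_of_mem hd]
  refine Prod.ext (Eq.symm ?_) (Eq.symm ?_)
  · exact (Submodule.Quotient.eq _).mpr (Submodule.subset_span
      ⟨⟨a, ha⟩, ⟨b, hb⟩, ⟨c, hc⟩, ⟨d, hd⟩, h, Or.inl rfl⟩)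
  · exact (Submodule.Quotient.eq _).mpr (Submodule.subset_span
      ⟨⟨a, ha⟩, ⟨b, hb⟩, ⟨c, hc⟩, ⟨d, hd⟩, h, Or.inr rfl⟩)

theorem isColoring_univLabel (hS : IsUnit S) (D : Diagram) :
    IsColoring (matrixPerm hS (D.KnotModule S)) D.nodes (univLabel S D) := by
  intro v hv
  have hi {e : ℕ} := mem_edges_of_mem_ins hv (e := e)
  have ho {e : ℕ} := mem_edges_of_mem_outs hv (e := e)
  rcases v with ⟨_ | _ | _, iL, iR, oL, oR⟩ | ⟨i, o⟩ <;> simp only [Node.ins, Node.outs] at hi ho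
  · exact matrixPerm_univLabel hS (hi (by simp)) (hi (by simp)) (ho (by simp)) (ho (by simp))
      (Or.inl hv)
  · refine Equiv.Perm.inv_eq_iff_eq.mpr (Eq.symm ?_)
    exact matrixPerm_univLabel hS (ho (by simp)) (ho (by simp)) (hi (by simp)) (hi (by simp))
      (Or.inr hv)
  · exact Prod.ext
      (univLabel_eq_of_through hv (hi (by simp)) (ho (by simp)) (Or.inl ⟨rfl, rfl⟩))
      (univLabel_eq_of_through hv (hi (by simp)) (ho (by simp)) (Or.inr ⟨rfl, rfl⟩))
  · exact univLabel_eq_of_through hv (hi (by simp)) (ho (by simp)) ⟨rfl, rfl⟩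

/-- Every colouring of a diagram by a module is the image of the universal one. -/
theorem exists_linearMap_univLabel (hS : IsUnit S) {D : Diagram} {f : ℕ → N}
    (hf : IsColoring (matrixPerm hS N) D.nodes f) :
    ∃ φ : D.KnotModule S →ₗ[R] N, ∀ e ∈ D.edges, φ (univLabel S D e) = f e := by
  let g : D.SemiArc → N := Quot.lift (fun e : D.Edge => f e.1)
    fun e e' ⟨v, hv, h⟩ => hf.eq_of_through hv h
  have hg (e : D.Edge) : Finsupp.linearCombination R g (gen R D e) = f e.1 :=
    (Finsupp.linearCombination_single R 1 _).trans (one_smul R _)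
  refine ⟨(Submodule.span R (D.relations S)).liftQ (Finsupp.linearCombination R g) ?_,
    fun e he => ?_⟩
  · rw [Submodule.span_le]
    rintro x ⟨a, b, c, d, h, hx⟩
    have h' : matrixPerm hS N (f a.1, f b.1) = (f c.1, f d.1) := by
      rcases h with h | h
      · exact hf _ h
      · exact (Equiv.Perm.inv_eq_iff_eq.mp (hf _ h)).symm
    rw [matrixPerm_apply, Prod.mk.injEq] at h'
    rcases hx with rfl | rfl
    · simp [hg, h'.1]
    · simp [hg, h'.2]
  · rw [univLabel_of_mem he, Submodule.Quotient.mk, ← hg ⟨e, he⟩]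
    exact Submodule.liftQ_apply _ _ _

theorem linearMap_ext_univLabel {D : Diagram} {φ ψ : D.KnotModule S →ₗ[R] N}
    (h : ∀ e ∈ D.edges, φ (univLabel S D e) = ψ (univLabel S D e)) : φ = ψ := by
  refine Submodule.linearMap_qext _ (Finsupp.lhom_ext' fun s => LinearMap.ext_ring ?_)
  induction s using Quot.ind with
  | mk e =>
    have := h e.1 e.2
    rw [univLabel_of_mem e.2] at this
    exact this

/-- Colourings of `D` and of `D'` by the set `X` correspond to each other bijectively: the label of
the edge `p i` in `D` is the label of the edge `p' i` in `D'`, for all `i`. -/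
structure ColoringMatch {X : Type*} (σ : Equiv.Perm (X × X)) (D D' : Diagram) {ι : Type*}
    (p p' : ι → ℕ) : Prop where
  mem_left : ∀ i, p i ∈ D.edges
  mem_right : ∀ i, p' i ∈ D'.edges
  exists_right : ∀ f, IsColoring σ D.nodes f →
    ∃ g, IsColoring σ D'.nodes g ∧ ∀ i, f (p i) = g (p' i)
  exists_left : ∀ g, IsColoring σ D'.nodes g →
    ∃ f, IsColoring σ D.nodes f ∧ ∀ i, f (p i) = g (p' i)
  unique_left : ∀ f f', IsColoring σ D.nodes f → IsColoring σ D.nodes f' →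
    (∀ i, f (p i) = f' (p i)) → ∀ e ∈ D.edges, f e = f' e
  unique_right : ∀ g g', IsColoring σ D'.nodes g → IsColoring σ D'.nodes g' →
    (∀ i, g (p' i) = g' (p' i)) → ∀ e ∈ D'.edges, g e = g' e

/-- By the universal property, diagrams with naturally corresponding colourings have isomorphic knot
modules. -/
theorem nonempty_linearEquiv_of_coloringMatch {R : Type*} [Ring R] {S : Matrix (Fin 2) (Fin 2) R}
    (hS : IsUnit S) {D D' : Diagram} {ι : Type*} {p p' : ι → ℕ}
    (h : ColoringMatch (matrixPerm hS (D.KnotModule S)) D D' p p')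
    (h' : ColoringMatch (matrixPerm hS (D'.KnotModule S)) D D' p p') :
    Nonempty (D.KnotModule S ≃ₗ[R] D'.KnotModule S) := by
  obtain ⟨f, hf, hfp⟩ := h'.exists_left _ (isColoring_univLabel hS D')
  obtain ⟨g, hg, hgp⟩ := h.exists_right _ (isColoring_univLabel hS D)
  obtain ⟨φ, hφ⟩ := exists_linearMap_univLabel hS hf
  obtain ⟨ψ, hψ⟩ := exists_linearMap_univLabel hS hg
  refine ⟨LinearEquiv.ofLinearMap φ ψ (linearMap_ext_univLabel ?_) (linearMap_ext_univLabel ?_)⟩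
  · refine h'.unique_right _ _ ((isColoring_univLabel hS D').map_linearMap (φ ∘ₗ ψ))
      ((isColoring_univLabel hS D').map_linearMap LinearMap.id) fun i => ?_
    simp [hψ _ (h.mem_right i), ← hgp, hφ _ (h.mem_left i), hfp]
  · refine h.unique_left _ _ ((isColoring_univLabel hS D).map_linearMap (ψ ∘ₗ φ))
      ((isColoring_univLabel hS D).map_linearMap LinearMap.id) fun i => ?_
    simp [hφ _ (h.mem_left i), hfp, hψ _ (h.mem_right i), ← hgp]

end Diagram

/-! ### Colourings under a change of names and under subdivision -/

theorem bind_ins_map_relabel (r : ℕ → ℕ) (V : Multiset Node) :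
    (V.map (Node.relabel r)).bind Node.ins = (V.bind Node.ins).map r := by
  rw [Multiset.bind_map, Multiset.map_bind]
  congr 1
  funext v
  cases v <;> rfl

namespace Diagram

variable {X : Type*} {σ : Equiv.Perm (X × X)} {D D' : Diagram}

theorem coloringMatch_relabel {r : ℕ → ℕ} (hr : Injective r)
    (h : D'.nodes = D.nodes.map (Node.relabel r)) :
    ColoringMatch σ D D' (fun e : {e // e ∈ D.edges} => e.1) (fun e => r e.1) := by
  have hE : D'.edges = D.edges.map r := by rw [edges, h, bind_ins_map_relabel]
  have hc {g : ℕ → X} : IsColoring σ D'.nodes g ↔ IsColoring σ D.nodes (g ∘ r) := by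
    rw [h, isColoring_map_relabel]
  refine ⟨fun e => e.2, fun e => ?_, fun f hf => ?_, fun g hg => ⟨g ∘ r, hc.mp hg, fun _ => rfl⟩,
    fun f f' _ _ hff e he => hff ⟨e, he⟩, fun g g' _ _ hgg e he => ?_⟩
  · rw [hE]
    exact Multiset.mem_map_of_mem r e.2
  · refine ⟨extend r f f, ?_, fun e => (hr.extend_apply f f e).symm⟩
    rwa [hc, extend_comp hr]
  · rw [hE, Multiset.mem_map] at he
    obtain ⟨e, he, rfl⟩ := he
    exact hgg ⟨e, he⟩

/-- Here `e` and `f` carry the same label in `D'`, and `e` carries it in `D`. -/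
theorem coloringMatch_subdivide {K : Multiset Node} {e f : ℕ} (hef : e ≠ f)
    (h : D.nodes = K.map (Node.relabel fun x => if x = f then e else x))
    (h' : D'.nodes = .point e f ::ₘ K) :
    ColoringMatch σ D D' (fun x : {x // x ∈ D'.edges} => if x.1 = f then e else x.1)
      (fun x => x.1) := by
  set r : ℕ → ℕ := fun x => if x = f then e else x with hr
  have hE : D.edges = (K.bind Node.ins).map r := by rw [edges, h, bind_ins_map_relabel]
  have hE' : D'.edges = e ::ₘ K.bind Node.ins := by simp [edges, h', Node.ins]
  have hfE : f ∈ K.bind Node.ins := by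
    have : f ∈ D'.edges :=
      mem_edges_of_mem_outs (v := .point e f) (by simp [h']) (by simp [Node.outs])
    rw [hE', Multiset.mem_cons] at this
    exact this.resolve_left hef.symm
  have hre : r e = e := by simp [hr]
  have hrf : r f = e := by simp [hr]
  have hc {c : ℕ → X} : IsColoring σ D.nodes c ↔ IsColoring σ K (c ∘ r) := by
    rw [h, isColoring_map_relabel]
  have hc' {c : ℕ → X} : IsColoring σ D'.nodes c ↔ c e = c f ∧ IsColoring σ K c := by
    rw [h', ← Multiset.singleton_add, isColoring_add]
    simp [IsColoring, Node.IsColored]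
  refine ⟨fun x => ?_, fun x => x.2, fun c hc₁ => ?_, fun c hc₁ => ?_, fun c c' _ _ hcc x hx => ?_,
    fun c c' _ _ hcc x hx => hcc ⟨x, hx⟩⟩
  · rw [hE]
    obtain ⟨x, hx⟩ := x
    change r x ∈ _
    rw [hE', Multiset.mem_cons] at hx
    rcases hx with h0 | h0
    · rw [h0, hre, ← hrf]
      exact Multiset.mem_map_of_mem r hfE
    · exact Multiset.mem_map_of_mem r h0
  · exact ⟨c ∘ r, hc'.mpr ⟨by simp [hre, hrf], hc.mp hc₁⟩, fun _ => rfl⟩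
  · obtain ⟨h1, h2⟩ := hc'.mp hc₁
    have hcr : c ∘ r = c := by
      funext x
      by_cases hx : x = f
      · rw [hx, comp_apply, hrf, h1]
      · simp [hr, hx]
    exact ⟨c, hc.mpr (by rwa [hcr]), fun x => congrFun hcr x⟩
  · rw [hE, Multiset.mem_map] at hx
    obtain ⟨x, hx, rfl⟩ := hx
    exact hcc ⟨x, by rw [hE']; exact Multiset.mem_cons_of_mem hx⟩

/-! ### Colourings under local moves -/

/-- The two sides `P`, `Q` of a local picture have the same incoming boundary edges `bi` and
outgoing boundary edges `bo`, and their inner edges are `I` and `J`. A colouring of one side induces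
a colouring of the other side with the same labels at the boundary, and the labels of the inner
edges are determined by those at the boundary. -/
structure LocalMatch (σ : Equiv.Perm (X × X)) (P Q : Multiset Node) (I J bi bo : Multiset ℕ) :
    Prop where
  ins_left : P.bind Node.ins = I + bi
  outs_left : P.bind Node.outs = I + bo
  ins_right : Q.bind Node.ins = J + bi
  outs_right : Q.bind Node.outs = J + bo
  exists_right : (J + bi).Nodup → (J + bo).Nodup → ∀ f, IsColoring σ P f →
    ∃ g, IsColoring σ Q g ∧ ∀ e ∉ J, f e = g e
  exists_left : (I + bi).Nodup → (I + bo).Nodup → ∀ g, IsColoring σ Q g →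
    ∃ f, IsColoring σ P f ∧ ∀ e ∉ I, f e = g e
  unique_left : ∀ f f', IsColoring σ P f → IsColoring σ P f' → (∀ e ∈ bi, f e = f' e) →
    (∀ e ∈ bo, f e = f' e) → ∀ e ∈ I, f e = f' e
  unique_right : ∀ g g', IsColoring σ Q g → IsColoring σ Q g' → (∀ e ∈ bi, g e = g' e) →
    (∀ e ∈ bo, g e = g' e) → ∀ e ∈ J, g e = g' e

/-- No inner edge occurs among the edges of the rest `K` of the diagram or at the boundary, since
every edge leaves and enters only one node; so a colouring can be changed at the inner edges. -/
theorem LocalMatch.coloringMatch {P Q K : Multiset Node} {I J bi bo : Multiset ℕ}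
    (h : LocalMatch σ P Q I J bi bo) (hD : D.nodes = P + K) (hD' : D'.nodes = Q + K) :
    ColoringMatch σ D D' (fun e : {e // e ∈ bi + K.bind Node.ins} => e.1) (fun e => e.1) := by
  have hE : D.edges = I + (bi + K.bind Node.ins) := by
    rw [edges, hD, Multiset.add_bind, h.ins_left, add_assoc]
  have hE' : D'.edges = J + (bi + K.bind Node.ins) := by
    rw [edges, hD', Multiset.add_bind, h.ins_right, add_assoc]
  have hM : bi + K.bind Node.ins = bo + K.bind Node.outs := by
    have := D.ins_eq_outs
    rw [hD, Multiset.add_bind, Multiset.add_bind, h.ins_left, h.outs_left, add_assoc,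
      add_assoc] at this
    exact add_left_cancel this
  have hn := D.nodup
  have hn' := D'.nodup
  rw [← edges, hE] at hn
  rw [← edges, hE'] at hn'
  have hd {e : ℕ} (he : e ∈ bi + K.bind Node.ins) : e ∉ I := fun hI =>
    Multiset.disjoint_left.mp (Multiset.nodup_add.mp hn).2.2 hI he
  have hd' {e : ℕ} (he : e ∈ bi + K.bind Node.ins) : e ∉ J := fun hJ =>
    Multiset.disjoint_left.mp (Multiset.nodup_add.mp hn').2.2 hJ he
  have hKi {e : ℕ} (he : e ∈ K.bind Node.ins) : e ∈ bi + K.bind Node.ins :=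
    Multiset.mem_add.mpr (Or.inr he)
  have hKo {e : ℕ} (he : e ∈ K.bind Node.outs) : e ∈ bi + K.bind Node.ins := by
    rw [hM]
    exact Multiset.mem_add.mpr (Or.inr he)
  have hbi {e : ℕ} (he : e ∈ bi) : e ∈ bi + K.bind Node.ins := Multiset.mem_add.mpr (Or.inl he)
  have hbo {e : ℕ} (he : e ∈ bo) : e ∈ bi + K.bind Node.ins := by
    rw [hM]
    exact Multiset.mem_add.mpr (Or.inl he)
  have sub {L B C : Multiset ℕ} (hL : (L + (B + C)).Nodup) : (L + B).Nodup := by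
    rw [← add_assoc] at hL
    exact (Multiset.nodup_add.mp hL).1
  refine ⟨fun e => ?_, fun e => ?_, fun f hf => ?_, fun g hg => ?_, fun f f' hf hf' hff e he => ?_,
    fun g g' hg hg' hgg e he => ?_⟩
  · rw [hE]
    exact Multiset.mem_add.mpr (Or.inr e.2)
  · rw [hE']
    exact Multiset.mem_add.mpr (Or.inr e.2)
  · rw [hD, isColoring_add] at hf
    obtain ⟨g, hg, hfg⟩ := h.exists_right (sub hn') (sub (hM ▸ hn')) f hf.1
    refine ⟨g, ?_, fun e => hfg _ (hd' e.2)⟩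
    rw [hD', isColoring_add]
    exact ⟨hg, hf.2.congr (fun e he => hfg _ (hd' (hKi he))) fun e he => hfg _ (hd' (hKo he))⟩
  · rw [hD', isColoring_add] at hg
    obtain ⟨f, hf, hfg⟩ := h.exists_left (sub hn) (sub (hM ▸ hn)) g hg.1
    refine ⟨f, ?_, fun e => hfg _ (hd e.2)⟩
    rw [hD, isColoring_add]
    exact ⟨hf, hg.2.congr (fun e he => (hfg _ (hd (hKi he))).symm)
      fun e he => (hfg _ (hd (hKo he))).symm⟩
  · rw [hE, Multiset.mem_add] at he
    rw [hD, isColoring_add] at hf hf'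
    rcases he with he | he
    · exact h.unique_left f f' hf.1 hf'.1 (fun e he => hff ⟨e, hbi he⟩)
        (fun e he => hff ⟨e, hbo he⟩) e he
    · exact hff ⟨e, he⟩
  · rw [hE', Multiset.mem_add] at he
    rw [hD', isColoring_add] at hg hg'
    rcases he with he | he
    · exact h.unique_right g g' hg.1 hg'.1 (fun e he => hgg ⟨e, hbi he⟩)
        (fun e he => hgg ⟨e, hbo he⟩) e he
    · exact hgg ⟨e, he⟩

theorem exists_update₁ (f : ℕ → X) (n : ℕ) (v : X) :
    ∃ g : ℕ → X, g n = v ∧ ∀ e ∉ ({n} : Multiset ℕ), f e = g e :=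
  ⟨update f n v, by simp, fun e he => by simp_all [update_of_ne]⟩

theorem exists_update₂ (f : ℕ → X) {n₁ n₂ : ℕ} (h : n₁ ≠ n₂) (v₁ v₂ : X) :
    ∃ g : ℕ → X, g n₁ = v₁ ∧ g n₂ = v₂ ∧ ∀ e ∉ ({n₁, n₂} : Multiset ℕ), f e = g e :=
  ⟨update (update f n₁ v₁) n₂ v₂, by simp [h], by simp, fun e he => by simp_all [update_of_ne]⟩

theorem exists_update₃ (f : ℕ → X) {n₁ n₂ n₃ : ℕ} (h₁₂ : n₁ ≠ n₂) (h₁₃ : n₁ ≠ n₃) (h₂₃ : n₂ ≠ n₃)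
    (v₁ v₂ v₃ : X) : ∃ g : ℕ → X, g n₁ = v₁ ∧ g n₂ = v₂ ∧ g n₃ = v₃ ∧
      ∀ e ∉ ({n₁, n₂, n₃} : Multiset ℕ), f e = g e :=
  ⟨update (update (update f n₁ v₁) n₂ v₂) n₃ v₃, by simp [h₁₂, h₁₃], by simp [h₂₃], by simp,
    fun e he => by simp_all [update_of_ne]⟩

theorem isColoring_singleton {v : Node} {f : ℕ → X} : IsColoring σ {v} f ↔ v.IsColored σ f := by
  simp [IsColoring]

theorem isColoring_pair {v w : Node} {f : ℕ → X} :
    IsColoring σ {v, w} f ↔ v.IsColored σ f ∧ w.IsColored σ f := by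
  simp [IsColoring]

theorem isColoring_triple {u v w : Node} {f : ℕ → X} :
    IsColoring σ {u, v, w} f ↔ u.IsColored σ f ∧ v.IsColored σ f ∧ w.IsColored σ f := by
  simp [IsColoring]

/-! ### First moves -/

/-- The common part of the first moves: at the crossing `v` of a curl, the labels of the incoming and
the outgoing edge agree and determine the label of the loop. -/
theorem localMatch_kink {v : Node} {a l b : ℕ} (hi : v.ins = {l} + {a}) (ho : v.outs = {l} + {b})
    {r : X → X} (hv : ∀ f : ℕ → X, v.IsColored σ f ↔ f a = f b ∧ f l = r (f a)) :
    LocalMatch σ {v} {.point a b} {l} 0 {a} {b} := by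
  constructor
  case ins_left => simpa using hi
  case outs_left => simpa using ho
  case ins_right => simp [Node.ins]
  case outs_right => simp [Node.outs]
  all_goals simp only [isColoring_singleton, hv]
  case exists_right => exact fun _ _ f h => ⟨f, h.1, fun _ _ => rfl⟩
  case exists_left =>
    intro hi ho g hg
    obtain ⟨f, hf, hfg⟩ := exists_update₁ g l (r (g a))
    simp only [Multiset.singleton_add, Multiset.nodup_cons, Multiset.mem_singleton] at hi ho
    have ha := hfg a (by simpa using Ne.symm hi.1)
    have hb := hfg b (by simpa using Ne.symm ho.1)
    exact ⟨f, ⟨by rw [← ha, ← hb, hg], by rw [hf, ha]⟩, fun e he => (hfg e he).symm⟩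
  case unique_left =>
    intro f f' h h' hi _ e he
    rw [Multiset.mem_singleton.mp he, h.2, h'.2, hi a (by simp)]
  case unique_right => simp

theorem localMatch_kinkRight {k : Kind} (hk : HasLoopLabels (kindPerm σ k)) (a l b : ℕ) :
    LocalMatch σ {.crossing k a l b l} {.point a b} {l} 0 {a} {b} := by
  obtain ⟨r, hr⟩ := hk.right
  exact localMatch_kink (add_comm {a} {l}) (add_comm {b} {l}) fun f => hr _ _ _

theorem localMatch_kinkLeft {k : Kind} (hk : HasLoopLabels (kindPerm σ k)) (a l b : ℕ) :
    LocalMatch σ {.crossing k l a l b} {.point a b} {l} 0 {a} {b} := by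
  obtain ⟨s, hs⟩ := hk.left
  exact localMatch_kink rfl rfl fun f => hs _ _ _

/-! ### Second moves -/

/-- The common part of all second moves: the condition `C` at the two crossings, in the labels of
`a`, `b`, `c`, `d`, `x`, `y`, has a solution for the inner edges `x`, `y` exactly if the labels of `a`, `c`
and of `b`, `d` agree, and then only one. -/
theorem localMatch_bigon {v w : Node} {a b c d x y : ℕ} {C : X → X → X → X → X → X → Prop}
    (hi : ({v, w} : Multiset Node).bind Node.ins = {x, y} + {a, b})
    (ho : ({v, w} : Multiset Node).bind Node.outs = {x, y} + {c, d})
    (hC : ∀ f : ℕ → X, v.IsColored σ f ∧ w.IsColored σ f ↔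
      C (f a) (f b) (f c) (f d) (f x) (f y))
    (h₁ : ∀ a b c d x y, C a b c d x y → a = c ∧ b = d)
    (h₂ : ∀ a b, ∃ x y, C a b a b x y)
    (h₃ : ∀ a b c d x y x' y', C a b c d x y → C a b c d x' y' → x = x' ∧ y = y') :
    LocalMatch σ {v, w} {.point a c, .point b d} {x, y} 0 {a, b} {c, d} := by
  constructor
  case ins_left => exact hi
  case outs_left => exact ho
  case ins_right => simp [Node.ins]
  case outs_right => simp [Node.outs]
  all_goals simp only [isColoring_pair, hC]
  case exists_right => exact fun _ _ f h => ⟨f, h₁ _ _ _ _ _ _ h, fun _ _ => rfl⟩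
  case exists_left =>
    rintro ni no g ⟨hac, hbd⟩
    simp only [Node.IsColored] at hac hbd
    obtain ⟨u, v, huv⟩ := h₂ (g a) (g b)
    simp only [Multiset.insert_eq_cons, Multiset.cons_add, Multiset.singleton_add,
      Multiset.nodup_cons, Multiset.mem_cons, Multiset.mem_singleton, not_or] at ni no
    obtain ⟨f, hx, hy, hfg⟩ := exists_update₂ g ni.1.1 u v
    refine ⟨f, ?_, fun e he => (hfg e he).symm⟩
    rw [hx, hy, ← hfg a (by simp; tauto), ← hfg b (by simp; tauto), ← hfg c (by simp; tauto),
      ← hfg d (by simp; tauto), ← hac, ← hbd]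
    exact huv
  case unique_left =>
    intro f f' h h' hi ho e he
    rw [hi a (by simp), hi b (by simp), ho c (by simp), ho d (by simp)] at h
    have := h₃ _ _ _ _ _ _ _ _ h h'
    simp only [Multiset.insert_eq_cons, Multiset.mem_cons, Multiset.mem_singleton] at he
    rcases he with rfl | rfl
    exacts [this.1, this.2]
  case unique_right => simp

theorem localMatch_parallel (k : Kind) (a b c d x y : ℕ) :
    LocalMatch σ {.crossing k a b x y, .crossing k.flip x y c d} {.point a c, .point b d}
      {x, y} 0 {a, b} {c, d} := by
  set T := kindPerm σ k with hT
  refine localMatch_bigon (C := fun a b c d x y => T (b, a) = (y, x) ∧ T (d, c) = (y, x))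
    ?_ ?_ (fun f => ?_) ?_ ?_ ?_
  · simp only [Multiset.insert_eq_cons, ← Multiset.singleton_add, Multiset.add_bind,
      Multiset.singleton_bind, Node.ins]
    abel
  · simp only [Multiset.insert_eq_cons, ← Multiset.singleton_add, Multiset.add_bind,
      Multiset.singleton_bind, Node.outs]
  · simp only [Node.IsColored, kindPerm_flip, ← hT, Equiv.Perm.inv_eq_iff_eq, eq_comm (b := T _)]
  · rintro a b c d x y ⟨h, h'⟩
    have := T.injective (h.trans h'.symm)
    simp_all
  · exact fun a b => ⟨(T (b, a)).2, (T (b, a)).1, rfl, rfl⟩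
  · rintro a b c d x y x' y' ⟨h, -⟩ ⟨h', -⟩
    have := h.symm.trans h'
    simp_all

theorem localMatch_antiparallelCw {k : Kind} (hk : IsNondegenerate (kindPerm σ k))
    (a b c d x y : ℕ) :
    LocalMatch σ {.crossing k a y d x, .crossing k.flip b x c y} {.point a c, .point b d}
      {x, y} 0 {a, b} {c, d} := by
  set T := kindPerm σ k with hT
  refine localMatch_bigon (C := fun a b c d x y => T (y, a) = (x, d) ∧ T (y, c) = (x, b))
    ?_ ?_ (fun f => ?_) ?_ ?_ ?_
  · simp only [Multiset.insert_eq_cons, ← Multiset.singleton_add, Multiset.add_bind,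
      Multiset.singleton_bind, Node.ins]
    abel
  · simp only [Multiset.insert_eq_cons, ← Multiset.singleton_add, Multiset.add_bind,
      Multiset.singleton_bind, Node.outs]
    abel
  · simp only [Node.IsColored, kindPerm_flip, ← hT, Equiv.Perm.inv_eq_iff_eq, eq_comm (b := T _)]
  · rintro a b c d x y ⟨h, h'⟩
    obtain rfl : a = c := (hk.fst y).1 (by simp [h, h'])
    have := h.symm.trans h'
    simp_all
  · intro a b
    obtain ⟨y, hy⟩ := (hk.snd a).2 b
    exact ⟨(T (y, a)).1, y, Prod.ext rfl hy, Prod.ext rfl hy⟩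
  · rintro a b c d x y x' y' ⟨h, -⟩ ⟨h', -⟩
    obtain rfl : y = y' := (hk.snd a).1 (by simp [h, h'])
    have := h.symm.trans h'
    simp_all

theorem localMatch_antiparallelCcw {k : Kind} (hk : IsNondegenerate (kindPerm σ k))
    (a b c d x y : ℕ) :
    LocalMatch σ {.crossing k y a x d, .crossing k.flip x b y c} {.point a c, .point b d}
      {x, y} 0 {a, b} {c, d} := by
  set T := kindPerm σ k with hT
  refine localMatch_bigon (C := fun a b c d x y => T (a, y) = (d, x) ∧ T (c, y) = (b, x))
    ?_ ?_ (fun f => ?_) ?_ ?_ ?_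
  · simp only [Multiset.insert_eq_cons, ← Multiset.singleton_add, Multiset.add_bind,
      Multiset.singleton_bind, Node.ins]
    abel
  · simp only [Multiset.insert_eq_cons, ← Multiset.singleton_add, Multiset.add_bind,
      Multiset.singleton_bind, Node.outs]
    abel
  · simp only [Node.IsColored, kindPerm_flip, ← hT, Equiv.Perm.inv_eq_iff_eq, eq_comm (b := T _)]
  · rintro a b c d x y ⟨h, h'⟩
    obtain rfl : a = c := (hk.snd y).1 (by simp [h, h'])
    have := h.symm.trans h'
    simp_all
  · intro a b
    obtain ⟨y, hy⟩ := (hk.fst a).2 b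
    exact ⟨(T (a, y)).2, y, Prod.ext hy rfl, Prod.ext hy rfl⟩
  · rintro a b c d x y x' y' ⟨h, -⟩ ⟨h', -⟩
    obtain rfl : y = y' := (hk.fst a).1 (by simp [h, h'])
    have := h.symm.trans h'
    simp_all

/-! ### Third moves -/

/-- The common part of the third moves: the conditions `C` and `C'` at the crossings on the two
sides, in the labels of the boundary edges `aᵢ`, `zᵢ` and of the inner edges, have at most one solution
for given labels at the boundary, and are solvable for the same labels at the boundary. -/
theorem localMatch_triangle {u v w u' v' w' : Node}
    {a₁ a₂ a₃ z₁ z₂ z₃ m₁ m₂ m₃ n₁ n₂ n₃ : ℕ} {C C' : X → X → X → X → X → X → X → X → X → Prop}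
    (hi : ({u, v, w} : Multiset Node).bind Node.ins = {m₁, m₂, m₃} + {a₁, a₂, a₃})
    (ho : ({u, v, w} : Multiset Node).bind Node.outs = {m₁, m₂, m₃} + {z₁, z₂, z₃})
    (hi' : ({u', v', w'} : Multiset Node).bind Node.ins = {n₁, n₂, n₃} + {a₁, a₂, a₃})
    (ho' : ({u', v', w'} : Multiset Node).bind Node.outs = {n₁, n₂, n₃} + {z₁, z₂, z₃})
    (hC : ∀ f : ℕ → X, u.IsColored σ f ∧ v.IsColored σ f ∧ w.IsColored σ f ↔
      C (f a₁) (f a₂) (f a₃) (f z₁) (f z₂) (f z₃) (f m₁) (f m₂) (f m₃))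
    (hC' : ∀ f : ℕ → X, u'.IsColored σ f ∧ v'.IsColored σ f ∧ w'.IsColored σ f ↔
      C' (f a₁) (f a₂) (f a₃) (f z₁) (f z₂) (f z₃) (f n₁) (f n₂) (f n₃))
    (hCC : ∀ a₁ a₂ a₃ z₁ z₂ z₃, (∃ m₁ m₂ m₃, C a₁ a₂ a₃ z₁ z₂ z₃ m₁ m₂ m₃) ↔
      ∃ n₁ n₂ n₃, C' a₁ a₂ a₃ z₁ z₂ z₃ n₁ n₂ n₃)
    (hu : ∀ a₁ a₂ a₃ z₁ z₂ z₃ m₁ m₂ m₃ n₁ n₂ n₃, C a₁ a₂ a₃ z₁ z₂ z₃ m₁ m₂ m₃ →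
      C a₁ a₂ a₃ z₁ z₂ z₃ n₁ n₂ n₃ → m₁ = n₁ ∧ m₂ = n₂ ∧ m₃ = n₃)
    (hu' : ∀ a₁ a₂ a₃ z₁ z₂ z₃ m₁ m₂ m₃ n₁ n₂ n₃, C' a₁ a₂ a₃ z₁ z₂ z₃ m₁ m₂ m₃ →
      C' a₁ a₂ a₃ z₁ z₂ z₃ n₁ n₂ n₃ → m₁ = n₁ ∧ m₂ = n₂ ∧ m₃ = n₃) :
    LocalMatch σ {u, v, w} {u', v', w'} {m₁, m₂, m₃} {n₁, n₂, n₃} {a₁, a₂, a₃} {z₁, z₂, z₃} := by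
  have ext {C : X → X → X → X → X → X → X → X → X → Prop} {l₁ l₂ l₃ : ℕ}
      (ni : (({l₁, l₂, l₃} : Multiset ℕ) + {a₁, a₂, a₃}).Nodup)
      (no : (({l₁, l₂, l₃} : Multiset ℕ) + {z₁, z₂, z₃}).Nodup) (f : ℕ → X)
      (h : ∃ y₁ y₂ y₃, C (f a₁) (f a₂) (f a₃) (f z₁) (f z₂) (f z₃) y₁ y₂ y₃) :
      ∃ g : ℕ → X, C (g a₁) (g a₂) (g a₃) (g z₁) (g z₂) (g z₃) (g l₁) (g l₂) (g l₃) ∧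
        ∀ e ∉ ({l₁, l₂, l₃} : Multiset ℕ), f e = g e := by
    obtain ⟨y₁, y₂, y₃, h⟩ := h
    simp only [Multiset.insert_eq_cons, Multiset.cons_add, Multiset.singleton_add,
      Multiset.nodup_cons, Multiset.mem_cons, Multiset.mem_singleton, not_or] at ni no
    obtain ⟨g, h₁, h₂, h₃, hfg⟩ := exists_update₃ f ni.1.1 ni.1.2.1 ni.2.1.1 y₁ y₂ y₃
    refine ⟨g, ?_, hfg⟩
    rw [h₁, h₂, h₃, ← hfg a₁ (by simp; tauto), ← hfg a₂ (by simp; tauto),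
      ← hfg a₃ (by simp; tauto), ← hfg z₁ (by simp; tauto), ← hfg z₂ (by simp; tauto),
      ← hfg z₃ (by simp; tauto)]
    exact h
  have uniq {C : X → X → X → X → X → X → X → X → X → Prop} {l₁ l₂ l₃ : ℕ}
      (hu : ∀ a₁ a₂ a₃ z₁ z₂ z₃ m₁ m₂ m₃ n₁ n₂ n₃, C a₁ a₂ a₃ z₁ z₂ z₃ m₁ m₂ m₃ →
        C a₁ a₂ a₃ z₁ z₂ z₃ n₁ n₂ n₃ → m₁ = n₁ ∧ m₂ = n₂ ∧ m₃ = n₃) (f g : ℕ → X)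
      (hf : C (f a₁) (f a₂) (f a₃) (f z₁) (f z₂) (f z₃) (f l₁) (f l₂) (f l₃))
      (hg : C (g a₁) (g a₂) (g a₃) (g z₁) (g z₂) (g z₃) (g l₁) (g l₂) (g l₃))
      (hi : ∀ e ∈ ({a₁, a₂, a₃} : Multiset ℕ), f e = g e)
      (ho : ∀ e ∈ ({z₁, z₂, z₃} : Multiset ℕ), f e = g e) :
      ∀ e ∈ ({l₁, l₂, l₃} : Multiset ℕ), f e = g e := by
    rw [hi a₁ (by simp), hi a₂ (by simp), hi a₃ (by simp), ho z₁ (by simp), ho z₂ (by simp),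
      ho z₃ (by simp)] at hf
    have := hu _ _ _ _ _ _ _ _ _ _ _ _ hf hg
    intro e he
    simp only [Multiset.insert_eq_cons, Multiset.mem_cons, Multiset.mem_singleton] at he
    rcases he with rfl | rfl | rfl
    exacts [this.1, this.2.1, this.2.2]
  constructor
  case ins_left => exact hi
  case outs_left => exact ho
  case ins_right => exact hi'
  case outs_right => exact ho'
  all_goals simp only [isColoring_triple, hC, hC']
  case exists_right =>
    exact fun ni no f hf => ext ni no f ((hCC _ _ _ _ _ _).mp ⟨_, _, _, hf⟩)
  case exists_left =>
    intro ni no g hg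
    obtain ⟨f, hf, hfg⟩ := ext ni no g ((hCC _ _ _ _ _ _).mpr ⟨_, _, _, hg⟩)
    exact ⟨f, hf, fun e he => (hfg e he).symm⟩
  case unique_left => exact uniq hu
  case unique_right => exact uniq hu'

theorem localMatch_braidTriangle {k₁₂ k₁₃ k₂₃ : Kind}
    (h : onRight (kindPerm σ k₂₃) * onLeft (kindPerm σ k₁₃) * onRight (kindPerm σ k₁₂) =
      onLeft (kindPerm σ k₁₂) * onRight (kindPerm σ k₁₃) * onLeft (kindPerm σ k₂₃))
    (a₁ a₂ a₃ z₁ z₂ z₃ m₁ m₂ m₃ n₁ n₂ n₃ : ℕ) :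
    LocalMatch σ
      {.crossing k₁₂ a₁ a₂ m₂ m₁, .crossing k₁₃ m₁ a₃ m₃ z₁, .crossing k₂₃ m₂ m₃ z₃ z₂}
      {.crossing k₂₃ a₂ a₃ n₃ n₂, .crossing k₁₃ a₁ n₃ z₃ n₁, .crossing k₁₂ n₁ n₂ z₂ z₁}
      {m₁, m₂, m₃} {n₁, n₂, n₃} {a₁, a₂, a₃} {z₁, z₂, z₃} := by
  generalize hT : kindPerm σ k₁₂ = T at *
  generalize hU : kindPerm σ k₁₃ = U at *
  generalize hV : kindPerm σ k₂₃ = V at *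
  refine localMatch_triangle
    (C := fun a₁ a₂ a₃ z₁ z₂ z₃ m₁ m₂ m₃ =>
      T (a₂, a₁) = (m₁, m₂) ∧ U (a₃, m₁) = (z₁, m₃) ∧ V (m₃, m₂) = (z₂, z₃))
    (C' := fun a₁ a₂ a₃ z₁ z₂ z₃ n₁ n₂ n₃ =>
      V (a₃, a₂) = (n₂, n₃) ∧ U (n₃, a₁) = (n₁, z₃) ∧ T (n₂, n₁) = (z₁, z₂))
    ?_ ?_ ?_ ?_ (fun f => ?_) (fun f => ?_) (fun a₁ a₂ a₃ z₁ z₂ z₃ => ?_) ?_ ?_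
  iterate 4
    simp only [Multiset.insert_eq_cons, ← Multiset.singleton_add, Multiset.add_bind,
      Multiset.singleton_bind, Node.ins, Node.outs]
    abel
  · simp only [Node.IsColored, hT, hU, hV]
  · simp only [Node.IsColored, hT, hU, hV]
  · have := congrArg (· (a₃, a₂, a₁)) h
    simp only [Equiv.Perm.mul_apply, onLeft, onRight, Equiv.coe_fn_mk, Prod.mk.injEq] at this
    obtain ⟨y₁, y₂⟩ := this
    constructor
    · rintro ⟨m₁, m₂, m₃, e₁, e₂, e₃⟩
      simp only [e₁, e₂, e₃, Prod.mk.injEq] at y₁ y₂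
      exact ⟨_, _, _, rfl, Prod.ext rfl y₂.2.symm, Prod.ext y₁.symm y₂.1.symm⟩
    · rintro ⟨n₁, n₂, n₃, e₁, e₂, e₃⟩
      simp only [e₁, e₂, e₃] at y₁ y₂
      exact ⟨_, _, _, rfl, Prod.ext y₁ rfl, y₂⟩
  · rintro a₁ a₂ a₃ z₁ z₂ z₃ m₁ m₂ m₃ n₁ n₂ n₃ ⟨e₁, e₂, -⟩ ⟨f₁, f₂, -⟩
    simp_all
  · rintro a₁ a₂ a₃ z₁ z₂ z₃ m₁ m₂ m₃ n₁ n₂ n₃ ⟨e₁, e₂, -⟩ ⟨f₁, f₂, -⟩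
    simp_all

theorem localMatch_cyclicTriangle {k₁₂ k₁₃ k₂₃ : Kind}
    (h : CyclicCompatible (kindPerm σ k₁₂) (kindPerm σ k₁₃) (kindPerm σ k₂₃))
    (h₁₂ : IsNondegenerate (kindPerm σ k₁₂)) (h₂₃ : IsNondegenerate (kindPerm σ k₂₃))
    (a₁ a₂ a₃ z₁ z₂ z₃ m₁ m₂ m₃ n₁ n₂ n₃ : ℕ) :
    LocalMatch σ
      {.crossing k₁₂ m₂ a₁ m₁ z₂, .crossing k₁₃ m₁ a₃ m₃ z₁, .crossing k₂₃ m₃ a₂ m₂ z₃}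
      {.crossing k₂₃ a₃ n₂ z₂ n₃, .crossing k₁₃ a₁ n₃ z₃ n₁, .crossing k₁₂ a₂ n₁ z₁ n₂}
      {m₁, m₂, m₃} {n₁, n₂, n₃} {a₁, a₂, a₃} {z₁, z₂, z₃} := by
  generalize hT : kindPerm σ k₁₂ = T at *
  generalize hU : kindPerm σ k₁₃ = U at *
  generalize hV : kindPerm σ k₂₃ = V at *
  refine localMatch_triangle
    (C := fun a₁ a₂ a₃ z₁ z₂ z₃ m₁ m₂ m₃ =>
      T (a₁, m₂) = (z₂, m₁) ∧ U (a₃, m₁) = (z₁, m₃) ∧ V (a₂, m₃) = (z₃, m₂))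
    (C' := fun a₁ a₂ a₃ z₁ z₂ z₃ n₁ n₂ n₃ =>
      V (n₂, a₃) = (n₃, z₂) ∧ U (n₃, a₁) = (n₁, z₃) ∧ T (n₁, a₂) = (n₂, z₁))
    ?_ ?_ ?_ ?_ (fun f => ?_) (fun f => ?_) h ?_ ?_
  iterate 4
    simp only [Multiset.insert_eq_cons, ← Multiset.singleton_add, Multiset.add_bind,
      Multiset.singleton_bind, Node.ins, Node.outs]
    abel
  · simp only [Node.IsColored, hT, hU, hV]
  · simp only [Node.IsColored, hT, hU, hV]
  · rintro a₁ a₂ a₃ z₁ z₂ z₃ m₁ m₂ m₃ n₁ n₂ n₃ ⟨e₁, e₂, -⟩ ⟨f₁, f₂, -⟩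
    obtain rfl : m₂ = n₂ := (h₁₂.fst a₁).1 (by simp [e₁, f₁])
    simp_all
  · rintro a₁ a₂ a₃ z₁ z₂ z₃ m₁ m₂ m₃ n₁ n₂ n₃ ⟨e₁, e₂, -⟩ ⟨f₁, f₂, -⟩
    obtain rfl : m₂ = n₂ := (h₂₃.snd a₃).1 (by simp [e₁, f₁])
    simp_all

/-! ### Invariance of the knot module -/

/-- The boundary and inner edges of a move do not depend on the birack. -/
theorem LocalMove.exists_localMatch {P Q : Multiset Node} (h : LocalMove P Q) :
    ∃ I J bi bo, ∀ (X : Type u) (σ : Equiv.Perm (X × X)), IsBirack σ →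
      LocalMatch σ P Q I J bi bo := by
  cases h with
  | virtualKinkRight a l b =>
    exact ⟨_, _, _, _, fun _ _ _ =>
      localMatch_kinkRight (k := .virtual) hasLoopLabels_prodComm a l b⟩
  | virtualKinkLeft a l b =>
    exact ⟨_, _, _, _, fun _ _ _ =>
      localMatch_kinkLeft (k := .virtual) hasLoopLabels_prodComm a l b⟩
  | parallel k a b c d x y => exact ⟨_, _, _, _, fun _ _ _ => localMatch_parallel k a b c d x y⟩
  | antiparallelCw k a b c d x y =>
    exact ⟨_, _, _, _, fun _ _ hσ => localMatch_antiparallelCw (hσ.kindPerm k) a b c d x y⟩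
  | antiparallelCcw k a b c d x y =>
    exact ⟨_, _, _, _, fun _ _ hσ => localMatch_antiparallelCcw (hσ.kindPerm k) a b c d x y⟩
  | braidTriangle k₁₂ k₁₃ k₂₃ hk =>
    exact ⟨_, _, _, _, fun _ _ hσ => localMatch_braidTriangle (hσ.braid hk) ..⟩
  | cyclicTriangle k₁₂ k₁₃ k₂₃ hk =>
    exact ⟨_, _, _, _, fun _ _ hσ =>
      localMatch_cyclicTriangle (hσ.cyclic hk) (hσ.kindPerm _) (hσ.kindPerm _) ..⟩

theorem ClassicalKink.exists_localMatch {P Q : Multiset Node} (h : ClassicalKink P Q) :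
    ∃ I J bi bo, ∀ (X : Type u) (σ : Equiv.Perm (X × X)), HasLoopLabels σ →
      LocalMatch σ P Q I J bi bo := by
  cases h with
  | right k _ a l b =>
    exact ⟨_, _, _, _, fun _ _ hσ => localMatch_kinkRight (hσ.kindPerm k) a l b⟩
  | left k _ a l b =>
    exact ⟨_, _, _, _, fun _ _ hσ => localMatch_kinkLeft (hσ.kindPerm k) a l b⟩

variable {R : Type*} [Ring R] {S : Matrix (Fin 2) (Fin 2) R}

theorem RegularMove.nonempty_linearEquiv (hS : IsLinearSwitch S) (hB : IsUnit (S 0 1))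
    (hC : IsUnit (S 1 0)) (h : RegularMove D D') :
    Nonempty (D.KnotModule S ≃ₗ[R] D'.KnotModule S) := by
  cases h with
  | relabel f hf h =>
    exact nonempty_linearEquiv_of_coloringMatch hS.isUnit (coloringMatch_relabel hf h)
      (coloringMatch_relabel hf h)
  | subdivide K e f hef h h' =>
    exact nonempty_linearEquiv_of_coloringMatch hS.isUnit (coloringMatch_subdivide hef h h')
      (coloringMatch_subdivide hef h h')
  | move P Q K hPQ h h' =>
    obtain ⟨I, J, bi, bo, m⟩ := hPQ.exists_localMatch
    exact nonempty_linearEquiv_of_coloringMatch hS.isUnit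
      ((m _ _ (isBirack_matrixPerm hS hB hC)).coloringMatch h h')
      ((m _ _ (isBirack_matrixPerm hS hB hC)).coloringMatch h h')

theorem Move.nonempty_linearEquiv (hS : IsLinearSwitch S) (hB : IsUnit (S 0 1))
    (hC : IsUnit (S 1 0)) {l : Rˣ} (h₁ : S 0 0 + S 0 1 * l = 1) (h₂ : S 1 0 + S 1 1 * l = l)
    (h : Move D D') : Nonempty (D.KnotModule S ≃ₗ[R] D'.KnotModule S) := by
  cases h with
  | regular h => exact h.nonempty_linearEquiv hS hB hC
  | kink P Q K hPQ h h' =>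
    obtain ⟨I, J, bi, bo, m⟩ := hPQ.exists_localMatch
    exact nonempty_linearEquiv_of_coloringMatch hS.isUnit
      ((m _ _ (hasLoopLabels_matrixPerm hS.isUnit hB hC h₁ h₂)).coloringMatch h h')
      ((m _ _ (hasLoopLabels_matrixPerm hS.isUnit hB hC h₁ h₂)).coloringMatch h h')

theorem nonempty_linearEquiv_of_eqvGen {r : Diagram → Diagram → Prop}
    (hr : ∀ D D', r D D' → Nonempty (D.KnotModule S ≃ₗ[R] D'.KnotModule S))
    (h : Relation.EqvGen r D D') : Nonempty (D.KnotModule S ≃ₗ[R] D'.KnotModule S) := by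
  induction h with
  | rel D D' h => exact hr D D' h
  | refl D => exact ⟨LinearEquiv.refl R _⟩
  | symm D D' _ ih => exact ih.map LinearEquiv.symm
  | trans D D' D'' _ _ ih ih' => exact ih.elim fun e => ih'.map e.trans

end Diagram

end VirtualKnot

theorem theorem8p3 {R : Type*} [Ring R] (S : Matrix (Fin 2) (Fin 2) R)
    (hS : VirtualKnot.IsLinearSwitch S) (hB : IsUnit (S 0 1)) (hC : IsUnit (S 1 0)) :
    (∀ D D' : VirtualKnot.Diagram, D.RegularlyEquivalent D' →
      Nonempty (D.KnotModule S ≃ₗ[R] D'.KnotModule S)) ∧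
    ((IsUnit (S 0 0) ∨ IsUnit (S 1 1) ∨ ∃ l : Rˣ, S.mulVec ![1, (l : R)] = ![1, (l : R)]) →
      ∀ D D' : VirtualKnot.Diagram, D.Equivalent D' →
        Nonempty (D.KnotModule S ≃ₗ[R] D'.KnotModule S)) := by
  refine ⟨fun D D' h => ?_, fun hl D D' h => ?_⟩
  · exact VirtualKnot.Diagram.nonempty_linearEquiv_of_eqvGen
      (fun _ _ m => m.nonempty_linearEquiv hS hB hC) h
  · obtain ⟨l, h₁, h₂⟩ := hS.exists_fixed hB hC hl
    exact VirtualKnot.Diagram.nonempty_linearEquiv_of_eqvGen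
      (fun _ _ m => m.nonempty_linearEquiv hS hB hC h₁ h₂) h
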